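/- Let $F$ be a field with $\operatorname{char}(F)\neq 2,3$ and let $A$ be a finite-dimensional semisimple (associative, hence unital) algebra over $F$. Let $T:A\to A$ be a local inner automorphism, i.e. an $F$-linear map such that for every $x\in A$ there is an inner automorphism $T_x$ of $A$ (a map of the form $y\mapsto a_x y a_x^{-1}$ with $a_x\in A$ invertible) satisfying $T(x)=T_x(x)$. Then $T$ is a Jordan automorphism of $A$, i.e. $T$ is bijective and $$T(xy+yx)=T(x)T(y)+T(y)T(x)\quad\text{for all }x,y\in A,$$ and $T$ belongs to the multiplication algebra $M(A)$, the algebra of all linear maps $A\to A$ of the form $x\mapsto\sum_{i=1}^n a_i x b_i$ with $n\ge 0$ and $a_i,b_i\in A$. -/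

import Mathlib

section

variable (F A : Type*) [Field F] [Ring A] [Algebra F A]

/-- The multiplication algebra `M(A)` of an `F`-algebra `A`: the algebra of all linear maps
`A → A` of the form `x ↦ ∑ i, a i * x * b i` (finite sums). -/
def multiplicationAlgebra : Subalgebra F (Module.End F A) where
  carrier := {f | ∃ (n : ℕ) (a b : Fin n → A), ∀ x : A, f x = ∑ i, a i * x * b i}
  mul_mem' := by
    rintro f g ⟨n, a, b, hf⟩ ⟨m, c, d, hg⟩
    refine ⟨n * m, fun k => a (finProdFinEquiv.symm k).1 * c (finProdFinEquiv.symm k).2,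
      fun k => d (finProdFinEquiv.symm k).2 * b (finProdFinEquiv.symm k).1, fun x => ?_⟩
    rw [Module.End.mul_apply, hf, hg,
      ← finProdFinEquiv.sum_comp, Fintype.sum_prod_type]
    refine Finset.sum_congr rfl fun i _ => ?_
    rw [Finset.mul_sum, Finset.sum_mul]
    refine Finset.sum_congr rfl fun j _ => ?_
    simp only [Equiv.symm_apply_apply, mul_assoc]
  add_mem' := by
    rintro f g ⟨n, a, b, hf⟩ ⟨m, c, d, hg⟩
    refine ⟨n + m, Fin.append a c, Fin.append b d, fun x => ?_⟩
    rw [LinearMap.add_apply, hf, hg, Fin.sum_univ_add]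
    simp only [Fin.append_left, Fin.append_right]
  algebraMap_mem' := by
    intro r
    refine ⟨1, fun _ => algebraMap F A r, fun _ => 1, fun x => ?_⟩
    simp [Module.algebraMap_end_apply, Algebra.smul_def]

variable {F A}

/-- A Jordan automorphism of `A`: a bijective linear map `J : A → A` with
`J (xy + yx) = J x J y + J y J x`. -/
def IsJordanAutomorphism (J : A →ₗ[F] A) : Prop :=
  Function.Bijective J ∧ ∀ x y : A, J (x * y + y * x) = J x * J y + J y * J x

/-- An inner automorphism of `A`: an automorphism of the form `x ↦ a x a⁻¹`
with `a` an invertible element of `A`. -/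
def IsInnerAutomorphism (φ : A ≃ₐ[F] A) : Prop :=
  ∃ a : Aˣ, ∀ x : A, φ x = (a : A) * x * ((a⁻¹ : Aˣ) : A)

/-- A local inner automorphism of `A`: a linear map `T : A → A` which at each point `x` agrees
with some inner automorphism of `A`, which may depend on `x`. -/
def IsLocalInnerAutomorphism (T : A →ₗ[F] A) : Prop :=
  ∀ x : A, ∃ φ : A ≃ₐ[F] A, IsInnerAutomorphism φ ∧ T x = φ x

end

open scoped TensorProduct

section TraceFunctionals

/-! Let `τ` be a trace functional, `τ (x * y) = τ (y * x)`. Since `T x` is conjugate to `x`, `τ (T x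
^ n) = τ (x ^ n)`. Polarizing `n = 2` and `n = 3`, which needs `2` and `3` invertible, shows that
`T` preserves `τ (x * y)` and `τ ((x * y + y * x) * z)`. As `T` is injective, hence surjective by
dimension, the Jordan defect `d` satisfies `τ (d * z) = 0` for all `z` and all `τ`; trace
functionals separate such `d` from `0` (`exists_trace_functional_mul_ne_zero`). Moreover `T` fixes
the center, so the Jordan identity makes it center-linear. Over `M(A)` the module `A` is semisimple
and its endomorphisms are multiplications by central elements, so Jacobson density puts `T` in
`M(A)`. -/

/-- A nontrivial finite-dimensional algebra admits a nonzero trace functional with values in the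
algebraic closure of the base field. -/
theorem exists_ne_zero_trace_functional (F D : Type*) [Field F] [Ring D] [Nontrivial D]
    [Algebra F D] [FiniteDimensional F D] :
    ∃ φ : D →ₗ[F] AlgebraicClosure F, φ ≠ 0 ∧ ∀ x y, φ (x * y) = φ (y * x) := by
  let E := AlgebraicClosure F
  let B := E ⊗[F] D
  have : IsArtinianRing B := IsArtinianRing.of_finite E B
  -- `B` need not be semisimple when `D` is inseparable over `F`; modulo its radical it splits into
  -- matrix algebras over `E`.
  let J := Ring.jacobson B
  have : IsSemisimpleRing (B ⧸ J) := IsSemiprimaryRing.isSemisimpleRing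
  have : Nontrivial (B ⧸ J) := Ideal.Quotient.nontrivial_iff.mpr (Ring.jacobson_lt_top B).ne
  have : Module.Finite E (B ⧸ J) :=
    Module.Finite.of_surjective (Ideal.Quotient.mkₐ E J).toLinearMap
      (Ideal.Quotient.mkₐ_surjective E J)
  obtain ⟨n, d, hd, ⟨e⟩⟩ := IsSemisimpleRing.exists_algEquiv_pi_matrix_of_isAlgClosed E (B ⧸ J)
  have hn : Nonempty (Fin n) := by
    by_contra h
    rw [not_nonempty_iff] at h
    exact not_subsingleton (B ⧸ J) e.toEquiv.subsingleton
  obtain ⟨i⟩ := hn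
  let ρ : B →ₐ[E] Matrix (Fin (d i)) (Fin (d i)) E :=
    (Pi.evalAlgHom E (fun i => Matrix (Fin (d i)) (Fin (d i)) E) i).comp
      (e.toAlgHom.comp (Ideal.Quotient.mkₐ E J))
  have hρ : Function.Surjective ρ := by
    intro M
    obtain ⟨b, hb⟩ := e.surjective (Pi.single i M)
    obtain ⟨c, rfl⟩ := Ideal.Quotient.mkₐ_surjective E J b
    refine ⟨c, ?_⟩
    change e (Ideal.Quotient.mkₐ E J c) i = M
    rw [hb, Pi.single_eq_same]
  let t : B →ₗ[E] E := Matrix.traceLinearMap (Fin (d i)) E E ∘ₗ ρ.toLinearMap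
  have ht : ∀ x y, t (x * y) = t (y * x) := fun x y => by
    change Matrix.trace (ρ (x * y)) = Matrix.trace (ρ (y * x))
    rw [map_mul, map_mul, Matrix.trace_mul_comm]
  have ht0 : t ≠ 0 := by
    intro h
    -- A matrix unit has trace `1` in every characteristic, unlike the identity.
    obtain ⟨b, hb⟩ := hρ (Matrix.single 0 0 1)
    have h1 : Matrix.trace (ρ b) = 0 := LinearMap.congr_fun h b
    rw [hb, Matrix.trace_single_eq_same] at h1
    exact one_ne_zero h1
  refine ⟨t.restrictScalars F ∘ₗ (Algebra.TensorProduct.includeRight : D →ₐ[F] B).toLinearMap,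
    fun h => ht0 ?_, fun x y => ?_⟩
  -- The image of `D` spans `B` over `E`, so `t` cannot vanish on it.
  · refine LinearMap.ext fun b => ?_
    induction b using TensorProduct.induction_on with
    | zero => simp
    | add x y hx hy => simp only [map_add, hx, hy]
    | tmul c x =>
      have h1 : t (1 ⊗ₜ x) = 0 := LinearMap.congr_fun h x
      have h2 : c ⊗ₜ[F] x = c • ((1 : E) ⊗ₜ[F] x) := by simp [TensorProduct.smul_tmul']
      rw [h2, map_smul, h1, smul_zero, LinearMap.zero_apply]
  · change t (1 ⊗ₜ (x * y)) = t (1 ⊗ₜ (y * x))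
    have h := ht (1 ⊗ₜ x) (1 ⊗ₜ y)
    rwa [Algebra.TensorProduct.tmul_mul_tmul, Algebra.TensorProduct.tmul_mul_tmul, one_mul] at h

/-- Trace functionals on a finite-dimensional semisimple algebra are jointly nondegenerate. -/
theorem exists_trace_functional_mul_ne_zero (F : Type*) {A : Type*} [Field F] [Ring A]
    [Algebra F A] [FiniteDimensional F A] [IsSemisimpleRing A] {d : A} (hd : d ≠ 0) :
    ∃ τ : A →ₗ[F] AlgebraicClosure F, (∀ x y, τ (x * y) = τ (y * x)) ∧ ∃ z, τ (d * z) ≠ 0 := by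
  obtain ⟨n, D, m, _, _, _, _, ⟨e⟩⟩ :=
    IsSemisimpleRing.exists_algEquiv_pi_matrix_divisionRing_finite F A
  obtain ⟨k, hk⟩ := Function.ne_iff.mp ((map_ne_zero_iff e e.injective).mpr hd)
  obtain ⟨i, j, hij⟩ : ∃ i j, e d k i j ≠ 0 := by
    by_contra! h
    exact hk (Matrix.ext h)
  obtain ⟨φ, hφ0, hφ⟩ := exists_ne_zero_trace_functional F (D k)
  obtain ⟨c, hc⟩ : ∃ c, φ c ≠ 0 := by
    by_contra! h
    exact hφ0 (LinearMap.ext h)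
  -- The matrix trace over a noncommutative `D k` is cyclic only after applying `φ`. The witness is
  -- chosen so that the trace in block `k` is exactly `c`.
  refine ⟨φ ∘ₗ Matrix.traceLinearMap (Fin (m k)) F (D k) ∘ₗ
    LinearMap.proj (φ := fun k => Matrix (Fin (m k)) (Fin (m k)) (D k)) k ∘ₗ e.toLinearMap,
    fun x y => ?_, e.symm (Pi.single k (Matrix.single j i ((e d k i j)⁻¹ * c))), ?_⟩
  · change φ (Matrix.trace (e (x * y) k)) = φ (Matrix.trace (e (y * x) k))
    simp only [map_mul, Pi.mul_apply, Matrix.trace, Matrix.diag_apply, Matrix.mul_apply, map_sum]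
    rw [Finset.sum_comm]
    exact Finset.sum_congr rfl fun _ _ => Finset.sum_congr rfl fun _ _ => hφ _ _
  · change φ (Matrix.trace (e (d * _) k)) ≠ 0
    rw [map_mul, AlgEquiv.apply_symm_apply, Pi.mul_apply, Pi.single_eq_same,
      Matrix.trace_mul_single]
    rwa [MulOpposite.smul_eq_mul_unop, MulOpposite.unop_op, mul_inv_cancel_left₀ hij]

end TraceFunctionals

section MultiplicationAlgebra

variable {F A : Type*} [Field F] [Ring A] [Algebra F A]

theorem mulLeft_mem_multiplicationAlgebra (a : A) :
    LinearMap.mulLeft F a ∈ multiplicationAlgebra F A :=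
  ⟨1, fun _ => a, fun _ => 1, fun x => by simp⟩

theorem mulRight_mem_multiplicationAlgebra (a : A) :
    LinearMap.mulRight F a ∈ multiplicationAlgebra F A :=
  ⟨1, fun _ => 1, fun _ => a, fun x => by simp⟩

/-- In a semisimple ring every two-sided ideal has a two-sided complement. -/
theorem Ideal.IsTwoSided.exists_isCompl [IsSemisimpleRing A] {I : Ideal A} (hI : I.IsTwoSided) :
    ∃ J : Ideal A, J.IsTwoSided ∧ IsCompl I J := by
  -- Two-sided ideals are the fully invariant submodules, which correspond to sets of isotypic
  -- components; complements of sets give complements of ideals.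
  have : ComplementedLattice (fullyInvariantSubmodule A A) :=
    (OrderIso.setIsotypicComponents (R := A) (M := A)).complementedLattice
  obtain ⟨⟨J, hJ⟩, hc⟩ := ComplementedLattice.exists_isCompl
    (⟨I, isFullyInvariant_iff_isTwoSided.mpr hI⟩ : fullyInvariantSubmodule A A)
  refine ⟨J, isFullyInvariant_iff_isTwoSided.mp hJ, ?_, ?_⟩
  · exact disjoint_iff.mpr congr(Subtype.val $(hc.inf_eq_bot))
  · exact codisjoint_iff.mpr congr(Subtype.val $(hc.sup_eq_top))

/-- Submodules over the multiplication algebra are two-sided ideals. -/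
def Submodule.toIdealOfMultiplicationAlgebra (N : Submodule (multiplicationAlgebra F A) A) :
    Ideal A where
  carrier := N
  add_mem' := N.add_mem
  zero_mem' := N.zero_mem
  smul_mem' a _ hx := N.smul_mem ⟨_, mulLeft_mem_multiplicationAlgebra a⟩ hx

theorem Submodule.isTwoSided_toIdealOfMultiplicationAlgebra
    (N : Submodule (multiplicationAlgebra F A) A) :
    N.toIdealOfMultiplicationAlgebra.IsTwoSided :=
  ⟨fun b hx => N.smul_mem ⟨_, mulRight_mem_multiplicationAlgebra b⟩ hx⟩

/-- Two-sided ideals are submodules over the multiplication algebra. -/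
def Ideal.toMultiplicationAlgebraSubmodule (F : Type*) [Field F] [Algebra F A] (I : Ideal A)
    (hI : I.IsTwoSided) : Submodule (multiplicationAlgebra F A) A where
  carrier := I
  add_mem' := I.add_mem
  zero_mem' := I.zero_mem
  smul_mem' := by
    rintro ⟨f, n, a, b, hf⟩ x hx
    change f x ∈ I
    rw [hf]
    exact I.sum_mem fun i _ => I.mul_mem_right _ (I.mul_mem_left _ hx)

/-- A semisimple algebra is a semisimple module over its multiplication algebra. -/
theorem isSemisimpleModule_multiplicationAlgebra [IsSemisimpleRing A] :
    IsSemisimpleModule (multiplicationAlgebra F A) A := by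
  rw [isSemisimpleModule_iff]
  refine ⟨fun N => ?_⟩
  obtain ⟨J, hJ, hc⟩ := (N.isTwoSided_toIdealOfMultiplicationAlgebra).exists_isCompl
  refine ⟨J.toMultiplicationAlgebraSubmodule F hJ, Submodule.disjoint_def.mpr fun x hx hx' =>
    Submodule.disjoint_def.mp hc.disjoint x hx hx', codisjoint_iff.mpr (eq_top_iff.mpr fun x _ => ?_)⟩
  obtain ⟨y, hy, z, hz, h⟩ := Submodule.mem_sup.mp
    (hc.sup_eq_top.ge (Submodule.mem_top : x ∈ (⊤ : Ideal A)))
  exact Submodule.mem_sup.mpr ⟨y, hy, z, hz, h⟩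

/-- A linear endomorphism of a finite-dimensional semisimple algebra which is linear over the
center belongs to the multiplication algebra. -/
theorem mem_multiplicationAlgebra_of_center_linear [FiniteDimensional F A] [IsSemisimpleRing A]
    (T : A →ₗ[F] A) (hT : ∀ z ∈ Subring.center A, ∀ x, T (z * x) = z * T x) :
    T ∈ multiplicationAlgebra F A := by
  have : IsSemisimpleModule (multiplicationAlgebra F A) A :=
    isSemisimpleModule_multiplicationAlgebra
  have hleft (f : Module.End (multiplicationAlgebra F A) A) (a x : A) : f (a * x) = a * f x :=
    f.map_smul ⟨_, mulLeft_mem_multiplicationAlgebra a⟩ x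
  have hright (f : Module.End (multiplicationAlgebra F A) A) (a x : A) : f (x * a) = f x * a :=
    f.map_smul ⟨_, mulRight_mem_multiplicationAlgebra a⟩ x
  have hone (f : Module.End (multiplicationAlgebra F A) A) (x : A) : f x = f 1 * x := by
    rw [← hright, one_mul]
  have hcenter (f : Module.End (multiplicationAlgebra F A) A) : f 1 ∈ Subring.center A :=
    Subring.mem_center_iff.mpr fun x => by rw [← hone, ← hleft, mul_one]
  -- Each `f` is multiplication by the central element `f 1`, so center-linearity says that `T`
  -- commutes with every `f`.
  let T' : Module.End (Module.End (multiplicationAlgebra F A) A) A :=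
    { T with
      map_smul' := fun f x => by
        change T (f x) = f (T x)
        rw [hone, hone f (T x), hT _ (hcenter f)] }
  -- Density gives agreement on finite sets only; a finite spanning set suffices.
  obtain ⟨s, hs⟩ := Module.Finite.fg_top (R := F) (M := A)
  obtain ⟨r, hr⟩ := jacobson_density (R := multiplicationAlgebra F A) (M := A) T' s
  have : T = r.1 := LinearMap.ext_on hs hr
  exact this ▸ r.2

end MultiplicationAlgebra

namespace IsLocalInnerAutomorphism

variable {F A : Type*} [Field F] [Ring A] [Algebra F A] {T : A →ₗ[F] A}

theorem exists_unit (hT : IsLocalInnerAutomorphism T) (x : A) :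
    ∃ a : Aˣ, T x = a * x * (a⁻¹ : Aˣ) := by
  obtain ⟨φ, ⟨a, ha⟩, hx⟩ := hT x
  exact ⟨a, hx.trans (ha x)⟩

theorem injective (hT : IsLocalInnerAutomorphism T) : Function.Injective T := by
  refine (injective_iff_map_eq_zero T).mpr fun x hx => ?_
  obtain ⟨φ, -, h⟩ := hT x
  exact (map_eq_zero_iff φ φ.injective).mp (h.symm.trans hx)

theorem apply_of_mem_center (hT : IsLocalInnerAutomorphism T) {z : A}
    (hz : z ∈ Subring.center A) : T z = z := by
  obtain ⟨a, h⟩ := hT.exists_unit z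
  rw [h, Subring.mem_center_iff.mp hz, mul_assoc, Units.mul_inv, mul_one]

section Trace

variable {E : Type*} [Field E] [Algebra F E] {τ : A →ₗ[F] E}

theorem trace_pow (hT : IsLocalInnerAutomorphism T) (hτ : ∀ x y, τ (x * y) = τ (y * x))
    (x : A) (n : ℕ) : τ (T x ^ n) = τ (x ^ n) := by
  obtain ⟨a, h⟩ := hT.exists_unit x
  rw [h, Units.conj_pow, hτ, ← mul_assoc, Units.inv_mul, one_mul]

theorem trace_mul (hT : IsLocalInnerAutomorphism T) (hτ : ∀ x y, τ (x * y) = τ (y * x))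
    (h2 : (2 : E) ≠ 0) (x y : A) : τ (T x * T y) = τ (x * y) := by
  have hxy := hT.trace_pow hτ (x + y) 2
  have hx := hT.trace_pow hτ x 2
  have hy := hT.trace_pow hτ y 2
  simp only [pow_two, map_add, mul_add, add_mul] at hxy hx hy
  rw [hτ (T y) (T x), hτ y x] at hxy
  exact mul_left_cancel₀ h2 (by linear_combination hxy - hx - hy)

theorem trace_jordan_mul (hT : IsLocalInnerAutomorphism T) (hτ : ∀ x y, τ (x * y) = τ (y * x))
    (h3 : (3 : E) ≠ 0) (x y z : A) :
    τ ((T x * T y + T y * T x) * T z) = τ ((x * y + y * x) * z) := by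
  -- Inclusion–exclusion leaves the six words using each of `u`, `v`, `w` once; they form two cyclic
  -- classes of three, whence the factor `3`.
  have hcube (u v w : A) : τ ((u + v + w) ^ 3) - τ ((u + v) ^ 3) - τ ((u + w) ^ 3)
      - τ ((v + w) ^ 3) + τ (u ^ 3) + τ (v ^ 3) + τ (w ^ 3) = 3 * τ ((u * v + v * u) * w) := by
    have e1 : τ (v * w * u) = τ (u * v * w) := by rw [hτ, mul_assoc]
    have e2 : τ (w * u * v) = τ (u * v * w) := by rw [mul_assoc, hτ]
    have e3 : τ (u * w * v) = τ (v * u * w) := by rw [hτ, mul_assoc]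
    have e4 : τ (w * v * u) = τ (v * u * w) := by rw [mul_assoc, hτ]
    simp only [pow_succ, pow_zero, one_mul, mul_add, add_mul, map_add]
    linear_combination e1 + e2 + e3 + e4
  apply mul_left_cancel₀ h3
  rw [← hcube, ← hcube]
  simp only [← map_add T, hT.trace_pow hτ]

end Trace

/-- On a finite-dimensional semisimple algebra over a field in which `2` and `3` are invertible,
local inner automorphisms are Jordan automorphisms. -/
theorem isJordanAutomorphism [FiniteDimensional F A] [IsSemisimpleRing A]
    (hT : IsLocalInnerAutomorphism T) (h2 : (2 : F) ≠ 0) (h3 : (3 : F) ≠ 0) :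
    IsJordanAutomorphism T := by
  have hsurj : Function.Surjective T := LinearMap.injective_iff_surjective.mp hT.injective
  refine ⟨⟨hT.injective, hsurj⟩, fun x y => ?_⟩
  by_contra hne
  obtain ⟨τ, hτ, z, hz⟩ := exists_trace_functional_mul_ne_zero F (sub_ne_zero.mpr hne)
  -- Both trace identities need the test element in the form `T w`.
  obtain ⟨w, rfl⟩ := hsurj z
  have h2' : (2 : AlgebraicClosure F) ≠ 0 := by
    exact map_ofNat (algebraMap F (AlgebraicClosure F)) 2 ▸ (map_ne_zero _).mpr h2
  have h3' : (3 : AlgebraicClosure F) ≠ 0 := by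
    exact map_ofNat (algebraMap F (AlgebraicClosure F)) 3 ▸ (map_ne_zero _).mpr h3
  rw [sub_mul, map_sub, hT.trace_mul hτ h2', hT.trace_jordan_mul hτ h3', sub_self] at hz
  exact hz rfl

end IsLocalInnerAutomorphism

/-- A Jordan automorphism fixing the center pointwise is linear over the center. -/
theorem IsJordanAutomorphism.map_center_mul {F A : Type*} [Field F] [Ring A] [Algebra F A]
    {T : A →ₗ[F] A} (hT : IsJordanAutomorphism T) (h2 : (2 : F) ≠ 0)
    (hfix : ∀ z ∈ Subring.center A, T z = z) {z : A} (hz : z ∈ Subring.center A) (x : A) :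
    T (z * x) = z * T x := by
  have h := hT.2 z x
  rw [hfix z hz, Subring.mem_center_iff.mp hz x, Subring.mem_center_iff.mp hz (T x), map_add,
    ← two_smul F, ← two_smul F (z * T x)] at h
  exact smul_right_injective A h2 h

theorem corollary3p9 {F A : Type*} [Field F] [Ring A] [Algebra F A] [FiniteDimensional F A]
    [IsSemisimpleRing A] (h2 : ringChar F ≠ 2) (h3 : ringChar F ≠ 3)
    (T : A →ₗ[F] A) (hT : IsLocalInnerAutomorphism T) :
    IsJordanAutomorphism T ∧ T ∈ multiplicationAlgebra F A := by
  have two_ne : (2 : F) ≠ 0 := Ring.two_ne_zero h2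
  have three_ne : (3 : F) ≠ 0 := fun h => by
    have hdvd : ringChar F ∣ 3 := ringChar.dvd (by exact_mod_cast h)
    rcases (Nat.dvd_prime Nat.prime_three).mp hdvd with h1 | h1
    · exact CharP.ringChar_ne_one h1
    · exact h3 h1
  have hJ := hT.isJordanAutomorphism two_ne three_ne
  exact ⟨hJ, mem_multiplicationAlgebra_of_center_linear T fun _ hz x =>
    hJ.map_center_mul two_ne (fun _ hw => hT.apply_of_mem_center hw) hz x⟩
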